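/- Let $n\ge 1$. For a continuous function $v\ge 0$ on a domain (nonempty connected open set) $U\subset\mathbb{R}^n$, write $\{v>0\}=\{x\in U: v(x)>0\}$ and call $\partial\{v>0\}\cap U$ its free boundary. Such a $v$ is a *strict comparison subsolution* (resp. *supersolution*) in $U$ if $v\in C^2(\{v>0\})$, $\Delta v\ge 0$ (resp. $\Delta v\le 0$) in $\{v>0\}$, and near each of its points $x_\circ$ the free boundary is a $C^2$ hypersurface with $\{v>0\}$ lying on exactly one side of it, and $v$ has at $x_\circ$ a gradient $\nabla v(x_\circ)$ from within $\{v>0\}$, of the form $a\nu$ with $a>1$ (resp. $a<1$), where $\nu$ is the unit normal at $x_\circ$ pointing into $\{v>0\}$ (so that $v_\nu(x_\circ)=a$). A continuous function $u\ge 0$ on $\mathbb{R}^n$ is a *viscosity solution of the classical one-phase problem* in $\mathbb{R}^n$ if $\Delta u=0$ in $\{u>0\}$ and there are no point $x_\circ\in\partial\{u>0\}$, domain $U\ni x_\circ$ and strict comparison subsolution (resp. supersolution) $v$ in $U$ with $x_\circ\in\partial\{v>0\}$ and $v\le u$ (resp. $v\ge u$) in a neighborhood of $x_\circ$. Let $u$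 be a viscosity solution of the classical one-phase problem in $\mathbb{R}^n$, let $\Lambda(u)=\{x\in\mathbb{R}^n:u(x)=0\}$, let $e_n=(0,\dots,0,1)$, and suppose that $$\Lambda(u)+\tau e_n\supset\Lambda(u)\qquad\text{for all }\tau>0 .$$ Then $u$ is monotone nondecreasing in the direction $e_n$, i.e. $u(x)\le u(x+\tau e_n)$ for all $x\in\mathbb{R}^n$ and all $\tau\ge 0$. -/

import Mathlib

open Set Filter Topology
open scoped InnerProductSpace

namespace OnePhase

/-- The set `{u > 0}` of a function `u` considered on `Ω ⊂ ℝⁿ`. -/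
def posSet {n : ℕ} (u : EuclideanSpace ℝ (Fin n) → ℝ) (Ω : Set (EuclideanSpace ℝ (Fin n))) :
    Set (EuclideanSpace ℝ (Fin n)) :=
  {x | x ∈ Ω ∧ 0 < u x}

/-- The free boundary `∂{u > 0} ∩ Ω`. -/
def freeBoundary {n : ℕ} (u : EuclideanSpace ℝ (Fin n) → ℝ)
    (Ω : Set (EuclideanSpace ℝ (Fin n))) : Set (EuclideanSpace ℝ (Fin n)) :=
  frontier (posSet u Ω) ∩ Ω

/-- The contact set `Λ(u) = {u = 0}` of a function on `ℝⁿ`. -/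
def contactSet {n : ℕ} (u : EuclideanSpace ℝ (Fin n) → ℝ) : Set (EuclideanSpace ℝ (Fin n)) :=
  {x | u x = 0}

/-- A domain: a nonempty, connected open set. -/
def IsDomainSet {n : ℕ} (Ω : Set (EuclideanSpace ℝ (Fin n))) : Prop :=
  IsOpen Ω ∧ IsConnected Ω

/-- Near its boundary point `x₀`, the set `S` is the side `{ρ > 0}` of the `C²` hypersurface
`{ρ = 0}`, and `ν` is the unit normal to that hypersurface at `x₀` pointing into `S`. -/
def IsC2InwardNormal {n : ℕ} (S : Set (EuclideanSpace ℝ (Fin n)))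
    (x₀ ν : EuclideanSpace ℝ (Fin n)) : Prop :=
  ∃ ρ : EuclideanSpace ℝ (Fin n) → ℝ, ContDiffAt ℝ 2 ρ x₀ ∧ ρ x₀ = 0 ∧ gradient ρ x₀ ≠ 0 ∧
    (∀ᶠ x in 𝓝 x₀, x ∈ S ↔ 0 < ρ x) ∧ ν = ‖gradient ρ x₀‖⁻¹ • gradient ρ x₀

/-- Strict comparison subsolution in the domain `U`. The gradient at a free boundary point is
taken from the positive side; it is `a • ν`, so that the inner normal derivative is `a`. -/
structure IsComparisonSubsolution {n : ℕ} (v : EuclideanSpace ℝ (Fin n) → ℝ)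
    (U : Set (EuclideanSpace ℝ (Fin n))) : Prop where
  domain : IsDomainSet U
  continuousOn : ContinuousOn v U
  nonneg : ∀ x ∈ U, 0 ≤ v x
  contDiffOn : ContDiffOn ℝ 2 v (posSet v U)
  laplacian_nonneg : ∀ x ∈ posSet v U, 0 ≤ Laplacian.laplacian v x
  boundary : ∀ x₀ ∈ freeBoundary v U, ∃ (ν : EuclideanSpace ℝ (Fin n)) (a : ℝ),
    IsC2InwardNormal (posSet v U) x₀ ν ∧ HasGradientWithinAt v (a • ν) (posSet v U) x₀ ∧ 1 < a

/-- Strict comparison supersolution in the domain `U`. -/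
structure IsComparisonSupersolution {n : ℕ} (v : EuclideanSpace ℝ (Fin n) → ℝ)
    (U : Set (EuclideanSpace ℝ (Fin n))) : Prop where
  domain : IsDomainSet U
  continuousOn : ContinuousOn v U
  nonneg : ∀ x ∈ U, 0 ≤ v x
  contDiffOn : ContDiffOn ℝ 2 v (posSet v U)
  laplacian_nonpos : ∀ x ∈ posSet v U, Laplacian.laplacian v x ≤ 0
  boundary : ∀ x₀ ∈ freeBoundary v U, ∃ (ν : EuclideanSpace ℝ (Fin n)) (a : ℝ),
    IsC2InwardNormal (posSet v U) x₀ ν ∧ HasGradientWithinAt v (a • ν) (posSet v U) x₀ ∧ a < 1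

/-- Viscosity solution of the classical one-phase problem in the domain `Ω`: no strict comparison
subsolution (supersolution), defined in any domain `U ⊂ Ω`, touches `u` from below (above) at a
free boundary point. -/
structure IsViscositySolution {n : ℕ} (u : EuclideanSpace ℝ (Fin n) → ℝ)
    (Ω : Set (EuclideanSpace ℝ (Fin n))) : Prop where
  domain : IsDomainSet Ω
  continuousOn : ContinuousOn u Ω
  nonneg : ∀ x ∈ Ω, 0 ≤ u x
  harmonic : InnerProductSpace.HarmonicOnNhd u (posSet u Ω)
  not_touch_below : ∀ x₀ ∈ freeBoundary u Ω, ∀ (U : Set (EuclideanSpace ℝ (Fin n)))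
    (v : EuclideanSpace ℝ (Fin n) → ℝ), U ⊆ Ω → IsComparisonSubsolution v U →
      ¬ (x₀ ∈ freeBoundary v U ∧ ∀ᶠ x in 𝓝 x₀, v x ≤ u x)
  not_touch_above : ∀ x₀ ∈ freeBoundary u Ω, ∀ (U : Set (EuclideanSpace ℝ (Fin n)))
    (v : EuclideanSpace ℝ (Fin n) → ℝ), U ⊆ Ω → IsComparisonSupersolution v U →
      ¬ (x₀ ∈ freeBoundary v U ∧ ∀ᶠ x in 𝓝 x₀, u x ≤ v x)

/-- `u ∈ 𝒢(e)`: `u` is a viscosity solution in all of `ℝⁿ` and `Λ(u) + τ e ⊃ Λ(u)` for all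
`τ > 0`. -/
def IsGraphicalSolution {n : ℕ} (u : EuclideanSpace ℝ (Fin n) → ℝ)
    (e : EuclideanSpace ℝ (Fin n)) : Prop :=
  IsViscositySolution u univ ∧
    ∀ τ : ℝ, 0 < τ → contactSet u ⊆ (fun x => x + τ • e) '' contactSet u

end OnePhase

/-! Monotonicity follows from linear growth, a sliding argument and Harnack's inequality. An
exponential barrier, used as a strict comparison subsolution, gives `u x ≤ C * dist x Λ`
(`le_growthConst_mul_dist`); with `harnack` this yields `u (x + τ • e) - u x ≥ -(M * τ)` for some
`M` (`exists_sub_ge`). Take the least such `M` and suppose `M > 0`. Near-optimality gives `y` and a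
step `σ` at which `w z = u (z + σ • e) - u z + M * σ` is tiny relative to `σ`. The hypothesis on the
contact set makes `{u > 0}` invariant under translation by `t • e`, `t ≥ 0`, so `w` is nonnegative
and harmonic there, and a ball of positivity around `y`, of radius `d`, can be slid along the whole
ray. `harnack_ray` keeps `w ≤ M * σ / 2` along a long stretch of the ray, so each step of length `σ`
lowers `u` by at least `M * σ / 2`. Since `u y ≤ C * d`, a stretch of length proportional to `d`
makes `u` negative, a contradiction. If the contact set is empty, `u` is a positive harmonic
function on the whole space and Liouville's theorem applies. -/

open MeasureTheory Metric

namespace OnePhase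

/-! ### Weighted mean value property and Harnack's inequality -/

section MeanValue

variable {E : Type*} [NormedAddCommGroup E]

/-- The radial kernel `(1 - ‖y‖²)₊`. -/
noncomputable def kernel (y : E) : ℝ := max (1 - ‖y‖ ^ 2) 0

lemma kernel_nonneg (y : E) : 0 ≤ kernel y := le_max_right _ _

lemma kernel_eq_zero {y : E} (hy : 1 ≤ ‖y‖) : kernel y = 0 :=
  max_eq_right (by nlinarith)

@[fun_prop]
lemma continuous_kernel : Continuous (kernel : E → ℝ) := by
  unfold kernel; fun_prop

lemma hasDerivAt_sq_max_zero (s : ℝ) :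
    HasDerivAt (fun s : ℝ => max s 0 ^ 2) (2 * max s 0) s := by
  rcases lt_trichotomy s 0 with hs | rfl | hs
  · have h : (fun s : ℝ => max s 0 ^ 2) =ᶠ[𝓝 s] fun _ => 0 := by
      filter_upwards [Iio_mem_nhds hs] with t ht
      simpa using (mem_Iio.1 ht).le
    rw [max_eq_right hs.le, mul_zero]
    exact (hasDerivAt_const s (0 : ℝ)).congr_of_eventuallyEq h
  · have h : HasDerivAt (fun s : ℝ => max s 0 ^ 2) 0 0 := by
      rw [hasDerivAt_iff_isLittleO_nhds_zero]
      have h2 : (fun h : ℝ => h ^ 2) =o[𝓝 0] fun h : ℝ => h := by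
        simpa using Asymptotics.isLittleO_pow_id (𝕜 := ℝ) one_lt_two
      refine Asymptotics.IsBigO.trans_isLittleO
        (Asymptotics.IsBigO.of_bound 1 (Eventually.of_forall fun t => ?_)) h2
      simp only [zero_add, max_self, smul_zero, sub_zero, norm_pow, one_mul, ne_eq,
        OfNat.ofNat_ne_zero, not_false_eq_true, zero_pow, Real.norm_eq_abs]
      refine pow_le_pow_left₀ (abs_nonneg _) ?_ 2
      rw [abs_of_nonneg (le_max_right t 0)]
      exact max_le (le_abs_self t) (abs_nonneg t)
    simpa using h
  · have h : (fun s : ℝ => max s 0 ^ 2) =ᶠ[𝓝 s] fun s => s ^ 2 := by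
      filter_upwards [Ioi_mem_nhds hs] with t ht
      rw [max_eq_left (mem_Ioi.1 ht).le]
    rw [max_eq_left hs.le]
    exact (by simpa using hasDerivAt_pow 2 s : HasDerivAt (fun s : ℝ => s ^ 2) (2 * s) s)
      |>.congr_of_eventuallyEq h

variable [InnerProductSpace ℝ E]

/-- Squaring makes the kernel differentiable across the unit sphere and exhibits the field `kernel y
• y` as a gradient, ready for integration by parts. -/
lemma hasFDerivAt_kernel_sq (y : E) :
    HasFDerivAt (fun y : E => kernel y ^ 2) (-(4 * kernel y) • innerSL ℝ y) y := by
  have h1 : HasFDerivAt (fun y : E => 1 - ‖y‖ ^ 2) (-(2 • innerSL ℝ y)) y :=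
    (hasStrictFDerivAt_norm_sq y).hasFDerivAt.const_sub 1
  have h2 := (hasDerivAt_sq_max_zero (1 - ‖y‖ ^ 2)).comp_hasFDerivAt y h1
  refine h2.congr_fderiv ?_
  ext z
  simp [kernel]
  ring

variable [FiniteDimensional ℝ E]

lemma hasCompactSupport_kernel : HasCompactSupport (kernel : E → ℝ) :=
  HasCompactSupport.intro (isCompact_closedBall (0 : E) 1) fun y hy =>
    kernel_eq_zero (by simpa using (not_le.1 fun h => hy (by simpa using h)).le)

lemma laplacian_eq_sum_fderiv_fderiv {ι : Type*} [Fintype ι] (b : OrthonormalBasis ι ℝ E)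
    (f : E → ℝ) (x : E) :
    Laplacian.laplacian f x = ∑ i, fderiv ℝ (fderiv ℝ f) x (b i) (b i) := by
  rw [InnerProductSpace.laplacian_eq_iteratedFDeriv_orthonormalBasis f b]
  simp [iteratedFDeriv_two_apply]

variable [MeasurableSpace E] [BorelSpace E]

lemma integrable_kernel_mul {g : E → ℝ} (hg : Continuous g) :
    Integrable (fun y => kernel y * g y) :=
  (continuous_kernel.mul hg).integrable_of_hasCompactSupport hasCompactSupport_kernel.mul_right

lemma integral_kernel_pos : 0 < ∫ y : E, kernel y := by
  refine continuous_kernel.integral_pos_of_hasCompactSupport_nonneg_nonzero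
    hasCompactSupport_kernel kernel_nonneg (x := 0) ?_
  simp [kernel]

/-- Since `kernel y • y` is `-1/4` times the gradient of `kernel ^ 2`, integration by parts turns
the integral into `t / 4` times that of `kernel ^ 2` against the Laplacian of `G`, and `kernel`
vanishes off the unit ball. This avoids surface integrals. -/
lemma integral_kernel_fderiv_eq_zero {G : E → ℝ} (hG : ContDiff ℝ 2 G) {q : E} {t : ℝ}
    (hΔ : ∀ y : E, ‖y‖ < 1 → Laplacian.laplacian G (q + t • y) = 0) :
    ∫ y : E, kernel y * fderiv ℝ G (q + t • y) y = 0 := by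
  set b := stdOrthonormalBasis ℝ E
  have hG1 : ContDiff ℝ 1 (fderiv ℝ G) := hG.fderiv_right (by norm_num)
  have hG1c : Continuous (fderiv ℝ G) := hG1.continuous
  have hG2 : Continuous (fderiv ℝ (fderiv ℝ G)) := hG1.continuous_fderiv (by norm_num)
  have hint (i) : Integrable fun y : E => kernel y * (⟪y, b i⟫_ℝ * fderiv ℝ G (q + t • y) (b i)) :=
    integrable_kernel_mul (by fun_prop)
  have hsum : ∀ y : E, kernel y * fderiv ℝ G (q + t • y) y =
      ∑ i, kernel y * (⟪y, b i⟫_ℝ * fderiv ℝ G (q + t • y) (b i)) := by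
    intro y
    have h := congrArg (fderiv ℝ G (q + t • y)) (b.sum_repr' y)
    simp only [map_sum, map_smul, smul_eq_mul] at h
    rw [← h, Finset.mul_sum]
    exact Finset.sum_congr rfl fun i _ => by rw [real_inner_comm]
  have hpart (i) : ∫ y : E, kernel y ^ 2 * (t * fderiv ℝ (fderiv ℝ G) (q + t • y) (b i) (b i)) =
      4 * ∫ y : E, kernel y * (⟪y, b i⟫_ℝ * fderiv ℝ G (q + t • y) (b i)) := by
    have hf' : ∀ y : E, fderiv ℝ (fun y : E => kernel y ^ 2) y (b i) =
        -(4 * kernel y) * ⟪y, b i⟫_ℝ := fun y => by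
      rw [(hasFDerivAt_kernel_sq y).fderiv]; simp
    have hg : ∀ y : E, HasFDerivAt (fun y => fderiv ℝ G (q + t • y) (b i))
        ((ContinuousLinearMap.apply ℝ ℝ (b i)).comp
          ((fderiv ℝ (fderiv ℝ G) (q + t • y)).comp (t • ContinuousLinearMap.id ℝ E))) y := by
      intro y
      have h1 : HasFDerivAt (fun y : E => q + t • y) (t • ContinuousLinearMap.id ℝ E) y :=
        ((hasFDerivAt_id y).const_smul t).const_add q
      have h2 := ((hG1.differentiable (by norm_num)) (q + t • y)).hasFDerivAt.comp y h1
      exact (ContinuousLinearMap.apply ℝ ℝ (b i)).hasFDerivAt.comp y h2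
    have hg' : ∀ y : E, fderiv ℝ (fun y => fderiv ℝ G (q + t • y) (b i)) y (b i) =
        t * fderiv ℝ (fderiv ℝ G) (q + t • y) (b i) (b i) := fun y => by
      rw [(hg y).fderiv]; simp
    have key := integral_mul_fderiv_eq_neg_fderiv_mul_of_integrable (μ := volume) (v := b i)
      (f := fun y : E => kernel y ^ 2) (g := fun y => fderiv ℝ G (q + t • y) (b i))
      ?_ ?_ ?_ (fun y _ => (hasFDerivAt_kernel_sq y).differentiableAt)
      (fun y _ => (hg y).differentiableAt)
    · simp only [hf', hg'] at key
      rw [key, ← integral_neg, ← integral_const_mul]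
      congr 1; ext y; ring
    · simp only [hf']
      refine ((hint i).const_mul (-4)).congr (Eventually.of_forall fun y => ?_)
      simp only; ring
    · simp only [hg', sq, mul_assoc]
      exact integrable_kernel_mul (by fun_prop)
    · simp only [sq, mul_assoc]
      exact integrable_kernel_mul (by fun_prop)
  have hzero : ∑ i, ∫ y : E, kernel y ^ 2 *
      (t * fderiv ℝ (fderiv ℝ G) (q + t • y) (b i) (b i)) = 0 := by
    rw [← integral_finsetSum]
    · rw [← integral_zero E ℝ]
      congr 1; ext y
      rcases lt_or_ge ‖y‖ 1 with hy | hy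
      · have := hΔ y hy
        rw [laplacian_eq_sum_fderiv_fderiv b] at this
        rw [← Finset.mul_sum, ← Finset.mul_sum, this]; simp
      · simp [kernel_eq_zero hy]
    · intro i _
      simp only [sq, mul_assoc]
      exact integrable_kernel_mul (by fun_prop)
  simp only [hsum]
  rw [integral_finsetSum _ fun i _ => hint i]
  simp only [hpart, ← Finset.mul_sum] at hzero
  linarith

/-- Mean value property with the radial weight `(1 - ‖y‖²)₊`. -/
lemma integral_kernel_mul_eq {G : E → ℝ} (hG : ContDiff ℝ 2 G) (hc : HasCompactSupport G)
    {q : E} {r : ℝ} (hr : 0 ≤ r) (hΔ : ∀ z ∈ ball q r, Laplacian.laplacian G z = 0) :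
    ∫ y : E, kernel y * G (q + r • y) = (∫ y : E, kernel y) * G q := by
  have hG1c : Continuous (fderiv ℝ G) := hG.continuous_fderiv (by norm_num)
  have hGc : Continuous G := hG.continuous
  obtain ⟨C, hC⟩ := (hc.fderiv ℝ).exists_bound_of_continuous hG1c
  have hderiv : ∀ t : ℝ, HasDerivAt (fun t : ℝ => ∫ y : E, kernel y * G (q + t • y))
      (∫ y : E, kernel y * fderiv ℝ G (q + t • y) y) t := by
    intro t
    refine (hasDerivAt_integral_of_dominated_loc_of_deriv_le (bound := fun y => kernel y * (C * ‖y‖))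
      (F := fun t y => kernel y * G (q + t • y))
      (F' := fun t y => kernel y * fderiv ℝ G (q + t • y) y) univ_mem ?_ ?_ ?_ ?_ ?_ ?_).2
    · exact Eventually.of_forall fun s =>
        (integrable_kernel_mul (by fun_prop : Continuous fun y : E => G (q + s • y))).1
    · exact integrable_kernel_mul (by fun_prop)
    · exact (integrable_kernel_mul
        (by fun_prop : Continuous fun y : E => fderiv ℝ G (q + t • y) y)).1
    · refine Eventually.of_forall fun y s _ => ?_
      rw [norm_mul, Real.norm_of_nonneg (kernel_nonneg y)]
      exact mul_le_mul_of_nonneg_left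
        ((ContinuousLinearMap.le_opNorm _ _).trans (by gcongr; exact hC _)) (kernel_nonneg y)
    · exact integrable_kernel_mul (by fun_prop)
    · refine Eventually.of_forall fun y s _ => ?_
      have h1 : HasDerivAt (fun s : ℝ => q + s • y) y s := by
        simpa using ((hasDerivAt_id s).smul_const y).const_add q
      exact (((hG.differentiable (by norm_num)) (q + s • y)).hasFDerivAt.comp_hasDerivAt s
        h1).const_mul _
  -- The weighted average is constant in the radius `t`; at `t = 0` it is the right-hand side.
  have := constant_of_has_deriv_right_zero
    (fun t _ => (hderiv t).continuousAt.continuousWithinAt) (a := 0) (b := r) (fun t ht => ?_) r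
      (right_mem_Icc.2 hr)
  · rw [this]; simp [integral_mul_const]
  · have hz := integral_kernel_fderiv_eq_zero hG (q := q) (t := t) fun y hy => hΔ _ ?_
    · rw [← hz]; exact (hderiv t).hasDerivWithinAt
    · rw [mem_ball_iff_norm, add_sub_cancel_left, norm_smul, Real.norm_of_nonneg ht.1]
      nlinarith [ht.1, ht.2, norm_nonneg y]

/-- The mean value property, written with the kernel `(r² - ‖z - q‖²)₊`. -/
lemma integral_scaled_kernel_mul_eq {G : E → ℝ} (hG : ContDiff ℝ 2 G) (hc : HasCompactSupport G)
    {q : E} {r : ℝ} (hr : 0 < r) (hΔ : ∀ z ∈ ball q r, Laplacian.laplacian G z = 0) :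
    ∫ z : E, max (r ^ 2 - ‖z - q‖ ^ 2) 0 * G z =
      r ^ (Module.finrank ℝ E + 2) * ((∫ y : E, kernel y) * G q) := by
  rw [← integral_kernel_mul_eq hG hc hr.le hΔ]
  have h1 : ∀ y : E, kernel y * G (q + r • y) =
      (fun w => (r ^ 2)⁻¹ * (max (r ^ 2 - ‖w‖ ^ 2) 0 * G (q + w))) (r • y) := by
    intro y
    have : max (r ^ 2 - ‖r • y‖ ^ 2) 0 = r ^ 2 * kernel y := by
      rw [kernel, mul_max_of_nonneg _ _ (sq_nonneg r), norm_smul, Real.norm_of_nonneg hr.le]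
      ring_nf
    simp only [this]
    field_simp
  have h2 : ∫ z : E, max (r ^ 2 - ‖z - q‖ ^ 2) 0 * G z =
      ∫ w : E, max (r ^ 2 - ‖w‖ ^ 2) 0 * G (q + w) := by
    rw [← integral_add_left_eq_self _ q]
    simp
  have h3 := Measure.integral_comp_smul_of_nonneg (volume : Measure E)
    (fun w => (r ^ 2)⁻¹ * (max (r ^ 2 - ‖w‖ ^ 2) 0 * G (q + w))) r (hR := hr.le)
  rw [integral_congr_ae (Eventually.of_forall h1), h3, integral_const_mul, h2, smul_eq_mul,
    pow_add]
  field_simp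

/-- Harnack inequality for nonnegative harmonic functions. -/
theorem harnack {f : E → ℝ} {S : Set E} (hS : IsOpen S)
    (hf : InnerProductSpace.HarmonicOnNhd f S) (hf0 : ∀ z ∈ S, 0 ≤ f z) {p q : E} {r R : ℝ}
    (hr : 0 < r) (hR : r + dist p q ≤ R) (hsub : closedBall p R ⊆ S) :
    r ^ (Module.finrank ℝ E + 2) * f q ≤ R ^ (Module.finrank ℝ E + 2) * f p := by
  have hR0 : 0 < R := by linarith [dist_nonneg (x := p) (y := q)]
  obtain ⟨δ, hδ, hδS⟩ := (isCompact_closedBall p R).exists_cthickening_subset_open hS hsub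
  rw [cthickening_closedBall hδ.le hR0.le] at hδS
  -- The cutoff gives a globally `C²`, compactly supported function that agrees with `f` near
  -- `closedBall p R`.
  let χ : ContDiffBump p := ⟨R + δ / 2, R + δ, by linarith, by linarith⟩
  set G : E → ℝ := fun z => χ z * f z with hGdef
  have hGC : ContDiff ℝ 2 G := by
    rw [contDiff_iff_contDiffAt]
    intro z
    by_cases hz : z ∈ S
    · exact χ.contDiff.contDiffAt.mul (hf z hz).1
    · have hz' : z ∉ tsupport χ := fun h => hz (hδS (by
        rw [χ.tsupport_eq] at h; simpa [χ, add_comm] using h))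
      have : G =ᶠ[𝓝 z] fun _ => 0 := by
        filter_upwards [notMem_tsupport_iff_eventuallyEq.1 hz'] with w hw
        simp [hGdef, hw]
      exact contDiffAt_const.congr_of_eventuallyEq this
  have hGc : HasCompactSupport G := χ.hasCompactSupport.mul_right
  have hGf : ∀ z ∈ ball p (R + δ / 2), G z = f z := fun z hz => by
    simp [hGdef, χ.one_of_mem_closedBall (ball_subset_closedBall hz)]
  have hGΔ : ∀ z ∈ ball p R, Laplacian.laplacian G z = 0 := by
    intro z hz
    have h1 : G =ᶠ[𝓝 z] f := by
      filter_upwards [isOpen_ball.mem_nhds hz] with w hw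
      exact hGf w (ball_subset_ball (by linarith) hw)
    rw [(InnerProductSpace.laplacian_congr_nhds h1).eq_of_nhds]
    exact (hf z (hsub (ball_subset_closedBall hz))).2.eq_of_nhds
  have hqr : ball q r ⊆ ball p R := ball_subset_ball' (by rw [dist_comm]; linarith)
  have hp := integral_scaled_kernel_mul_eq hGC hGc hR0 hGΔ
  have hq := integral_scaled_kernel_mul_eq hGC hGc hr fun z hz => hGΔ z (hqr hz)
  have hp' : G p = f p := hGf p (mem_ball_self (by linarith))
  have hq' : G q = f q := hGf q (ball_subset_ball (by linarith) (hqr (mem_ball_self hr)))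
  rw [hp'] at hp
  rw [hq'] at hq
  have hcont : Continuous G := hGC.continuous
  -- The kernel at `q` lies below the kernel at `p`: with `D = dist p q` and `s = ‖z - q‖ ≤ r`, `R ^
  -- 2 - ‖z - p‖ ^ 2 ≥ (r + D) ^ 2 - (s + D) ^ 2 ≥ r ^ 2 - s ^ 2`.
  have hle : ∫ z : E, max (r ^ 2 - ‖z - q‖ ^ 2) 0 * G z ≤
      ∫ z : E, max (R ^ 2 - ‖z - p‖ ^ 2) 0 * G z := by
    refine integral_mono (Continuous.integrable_of_hasCompactSupport (by fun_prop) hGc.mul_left)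
      (Continuous.integrable_of_hasCompactSupport (by fun_prop) hGc.mul_left) fun z => ?_
    have hG0 : 0 ≤ G z := by
      by_cases hz : z ∈ S
      · exact mul_nonneg χ.nonneg (hf0 z hz)
      · have : z ∉ ball p (R + δ) := fun h => hz (hδS (by
          simpa [add_comm] using ball_subset_closedBall h))
        simp [hGdef, χ.zero_of_le_dist (by simpa [χ] using this)]
    refine mul_le_mul_of_nonneg_right (max_le ?_ (le_max_right _ _)) hG0
    rcases le_total r ‖z - q‖ with h | h
    · exact (by nlinarith : r ^ 2 - ‖z - q‖ ^ 2 ≤ 0).trans (le_max_right _ _)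
    · refine le_trans ?_ (le_max_left _ _)
      have h1 : ‖z - p‖ ≤ ‖z - q‖ + dist p q := by
        rw [← dist_eq_norm, ← dist_eq_norm, dist_comm p q]; exact dist_triangle _ _ _
      have h0 : 0 ≤ dist p q := dist_nonneg
      nlinarith [norm_nonneg (z - q), norm_nonneg (z - p)]
  rw [hp, hq] at hle
  have hpos := integral_kernel_pos (E := E)
  refine le_of_mul_le_mul_left ?_ hpos
  linarith

end MeanValue

/-! ### Second-order condition at a local minimum -/

section LocalMin

variable {E : Type*} [NormedAddCommGroup E] [InnerProductSpace ℝ E] [FiniteDimensional ℝ E]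

/-- A negative second derivative along a basis vector would make the point also a local maximum on
that line; the restriction would then be locally constant, with zero second derivative. -/
lemma laplacian_nonneg_of_isLocalMin {f : E → ℝ} {x : E} (hf : ContDiffAt ℝ 2 f x)
    (hx : IsLocalMin f x) : 0 ≤ Laplacian.laplacian f x := by
  rw [laplacian_eq_sum_fderiv_fderiv (stdOrthonormalBasis ℝ E)]
  refine Finset.sum_nonneg fun i _ => ?_
  set e := stdOrthonormalBasis ℝ E i
  by_contra! hneg
  have hline : ∀ t : ℝ, HasDerivAt (fun t : ℝ => x + t • e) e t := fun t => by
    simpa using ((hasDerivAt_id t).smul_const e).const_add x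
  have hx0 : x + (0 : ℝ) • e = x := by simp
  have htend : Tendsto (fun t : ℝ => x + t • e) (𝓝 0) (𝓝 x) := by
    simpa [hx0] using (hline 0).continuousAt.tendsto
  set g : ℝ → ℝ := fun t => f (x + t • e)
  have hg' : deriv g =ᶠ[𝓝 0] fun t => fderiv ℝ f (x + t • e) e := by
    filter_upwards [htend.eventually (hf.eventually (by simp))] with t ht
    exact ((ht.differentiableAt (by norm_num)).hasFDerivAt.comp_hasDerivAt t (hline t)).deriv
  have hg'' : deriv (deriv g) 0 = fderiv ℝ (fderiv ℝ f) x e e := by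
    rw [hg'.deriv_eq]
    have h1 : HasFDerivAt (fderiv ℝ f) (fderiv ℝ (fderiv ℝ f) x) (x + (0 : ℝ) • e) := by
      rw [hx0]
      exact ((hf.fderiv_right (m := 1) (by norm_num)).differentiableAt (by norm_num)).hasFDerivAt
    have h2 := h1.comp_hasDerivAt (0 : ℝ) (hline 0)
    exact ((ContinuousLinearMap.apply ℝ ℝ e).hasFDerivAt.comp_hasDerivAt (0 : ℝ) h2).deriv
  have hmin : IsLocalMin g 0 := by
    have : ∀ᶠ t in 𝓝 (0 : ℝ), f x ≤ f (x + t • e) := htend.eventually hx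
    simpa [IsLocalMin, IsMinFilter, g] using this
  have hmax : IsLocalMax g 0 := by
    refine isLocalMax_of_deriv_deriv_neg (by rw [hg'']; exact hneg) hmin.deriv_eq_zero ?_
    have : ContinuousAt f (x + (0 : ℝ) • e) := by rw [hx0]; exact hf.continuousAt
    exact ContinuousAt.comp (f := fun t : ℝ => x + t • e) this (hline 0).continuousAt
  have hconst : g =ᶠ[𝓝 0] fun _ => g 0 := by
    filter_upwards [hmin, hmax] with t h1 h2 using le_antisymm h2 h1
  have : deriv (deriv g) 0 = 0 := by
    have h1 := hconst.deriv
    rw [h1.deriv_eq]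
    simp
  rw [hg''] at this
  exact hneg.ne this

end LocalMin

/-! ### The exponential barrier -/

section Barrier

variable {E : Type*} [NormedAddCommGroup E] [InnerProductSpace ℝ E]

/-- The radial function `A (exp (-α ‖z - x‖²) - c)`. -/
noncomputable def barrier (A α c : ℝ) (x z : E) : ℝ := A * (Real.exp (-α * ‖z - x‖ ^ 2) - c)

lemma contDiff_barrier (A α c : ℝ) (x : E) : ContDiff ℝ 2 (barrier A α c x) := by
  unfold barrier
  exact contDiff_const.mul (((contDiff_const.mul
    ((contDiff_id.sub contDiff_const).norm_sq ℝ)).exp).sub contDiff_const)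

lemma hasFDerivAt_exp_neg_norm_sq (α : ℝ) (x z : E) :
    HasFDerivAt (fun z => Real.exp (-α * ‖z - x‖ ^ 2))
      ((-(2 * α) * Real.exp (-α * ‖z - x‖ ^ 2)) • innerSL ℝ (z - x)) z := by
  have h1 : HasFDerivAt (fun z : E => z - x) (ContinuousLinearMap.id ℝ E) z :=
    (hasFDerivAt_id z).sub_const x
  have h2 := ((hasStrictFDerivAt_norm_sq (z - x)).hasFDerivAt.comp z h1).const_mul (-α)
  refine h2.exp.congr_fderiv ?_
  ext w
  simp
  ring

lemma hasFDerivAt_barrier (A α c : ℝ) (x z : E) :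
    HasFDerivAt (barrier A α c x)
      ((-(2 * α * A) * Real.exp (-α * ‖z - x‖ ^ 2)) • innerSL ℝ (z - x)) z := by
  refine (((hasFDerivAt_exp_neg_norm_sq α x z).sub_const c).const_mul A).congr_fderiv ?_
  ext w
  simp
  ring

lemma norm_gradient_barrier [CompleteSpace E] {A α : ℝ} (hA : 0 ≤ A) (hα : 0 ≤ α) (c : ℝ)
    (x z : E) :
    ‖gradient (barrier A α c x) z‖ = 2 * α * A * Real.exp (-α * ‖z - x‖ ^ 2) * ‖z - x‖ := by
  rw [gradient, LinearIsometryEquiv.norm_map, (hasFDerivAt_barrier A α c x z).fderiv, norm_smul,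
    innerSL_apply_norm, norm_mul, norm_neg, Real.norm_of_nonneg (by positivity),
    Real.norm_of_nonneg (Real.exp_pos _).le]

/-- For `A, α > 0` this is positive exactly where `2 * α * ‖z - x‖ ^ 2` exceeds the dimension, so a
large `α` gives strict subharmonicity off a small ball. -/
lemma laplacian_barrier [FiniteDimensional ℝ E] (A α c : ℝ) (x z : E) :
    Laplacian.laplacian (barrier A α c x) z = 2 * α * A * Real.exp (-α * ‖z - x‖ ^ 2) *
      (2 * α * ‖z - x‖ ^ 2 - Module.finrank ℝ E) := by
  set b := stdOrthonormalBasis ℝ E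
  rw [laplacian_eq_sum_fderiv_fderiv b]
  have hfd : fderiv ℝ (barrier A α c x) = fun z =>
      (-(2 * α * A) * Real.exp (-α * ‖z - x‖ ^ 2)) • innerSL ℝ (z - x) :=
    funext fun z => (hasFDerivAt_barrier A α c x z).fderiv
  have h1 : HasFDerivAt (fun z : E => innerSL ℝ (z - x)) (innerSL ℝ : E →L[ℝ] E →L[ℝ] ℝ) z :=
    (innerSL ℝ : E →L[ℝ] E →L[ℝ] ℝ).hasFDerivAt.comp z ((hasFDerivAt_id z).sub_const x)
  have h2 : HasFDerivAt (fun z : E => (-(2 * α * A) * Real.exp (-α * ‖z - x‖ ^ 2)) •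
      innerSL ℝ (z - x)) _ z :=
    ((hasFDerivAt_exp_neg_norm_sq α x z).const_mul (-(2 * α * A))).smul h1
  have hi (i) : fderiv ℝ (fderiv ℝ (barrier A α c x)) z (b i) (b i) =
      2 * α * A * Real.exp (-α * ‖z - x‖ ^ 2) * (2 * α * ⟪b i, z - x⟫_ℝ ^ 2 - 1) := by
    rw [hfd, h2.fderiv]
    have hb : (innerSL ℝ : E →L[ℝ] E →L[ℝ] ℝ) (b i) (b i) = 1 := by
      change ⟪b i, b i⟫_ℝ = 1
      simp
    simp [hb, real_inner_comm (b i), inner_sub_right]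
    ring
  simp only [hi]
  rw [← Finset.mul_sum, Finset.sum_sub_distrib, ← Finset.mul_sum]
  congr 2
  · rw [← b.sum_sq_norm_inner_right (z - x)]
    simp
  · simp

end Barrier

/-! ### Comparison subsolutions and linear growth -/

variable {n : ℕ}

/-- The free boundary of the positive part lies in the zero level of `v`, where the gradient does
not vanish; hence `v` itself serves as the defining function `ρ`. -/
lemma isComparisonSubsolution_max {v : EuclideanSpace ℝ (Fin n) → ℝ}
    {U : Set (EuclideanSpace ℝ (Fin n))} (hU : IsDomainSet U) (hv : ContDiff ℝ 2 v)
    (hΔ : ∀ x ∈ U, 0 < v x → 0 ≤ Laplacian.laplacian v x)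
    (hgrad : ∀ x ∈ U, v x = 0 → 1 < ‖gradient v x‖) :
    IsComparisonSubsolution (fun x => max (v x) 0) U := by
  have hvc : Continuous v := hv.continuous
  have hpos : posSet (fun x => max (v x) 0) U = U ∩ {x | 0 < v x} := by
    ext x; simp [posSet]
  have hloc : ∀ x ∈ posSet (fun x => max (v x) 0) U, (fun x => max (v x) 0) =ᶠ[𝓝 x] v := by
    intro x hx
    rw [hpos] at hx
    filter_upwards [hvc.continuousAt.eventually (lt_mem_nhds hx.2)] with y hy
    exact max_eq_left hy.le
  refine ⟨hU, by fun_prop, fun x _ => le_max_right _ _, fun x hx => ?_, fun x hx => ?_,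
    fun x₀ hx₀ => ?_⟩
  · exact (hv.contDiffAt.congr_of_eventuallyEq (hloc x hx)).contDiffWithinAt
  · rw [(InnerProductSpace.laplacian_congr_nhds (hloc x hx)).eq_of_nhds]
    rw [hpos] at hx
    exact hΔ x hx.1 hx.2
  · have hopen : IsOpen (posSet (fun x => max (v x) 0) U) := by
      rw [hpos]; exact hU.1.inter (isOpen_lt continuous_const hvc)
    obtain ⟨hfr, hxU⟩ := hx₀
    rw [hopen.frontier_eq] at hfr
    have hle : v x₀ ≤ 0 := not_lt.1 fun h => hfr.2 (by rw [hpos]; exact ⟨hxU, h⟩)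
    have hge : 0 ≤ v x₀ :=
      closure_minimal (fun x hx => by rw [hpos] at hx; exact (show 0 < v x from hx.2).le)
        (isClosed_le continuous_const hvc) hfr.1
    have hv0 : v x₀ = 0 := le_antisymm hle hge
    have hg := hgrad x₀ hxU hv0
    have hg0 : ‖gradient v x₀‖ ≠ 0 := by positivity
    refine ⟨‖gradient v x₀‖⁻¹ • gradient v x₀, ‖gradient v x₀‖,
      ⟨v, hv.contDiffAt, hv0, norm_ne_zero_iff.1 hg0, ?_, rfl⟩, ?_, hg⟩
    · filter_upwards [hU.1.mem_nhds hxU] with x hx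
      simp [hpos, hx]
    · rw [smul_inv_smul₀ hg0]
      refine HasGradientWithinAt.congr
        (HasFDerivAt.hasFDerivWithinAt (hv.differentiable (by norm_num) x₀).hasGradientAt) ?_ ?_
      · intro x hx
        rw [hpos] at hx
        exact max_eq_left (show 0 < v x from hx.2).le
      · simp [hv0]

/-- The constant in the linear growth estimate. -/
noncomputable def growthConst (n : ℕ) : ℝ := 2 ^ (n + 2) * Real.exp (8 * n + 1)

lemma isOpen_posSet_univ {u : EuclideanSpace ℝ (Fin n) → ℝ} (hu : IsViscositySolution u univ) :
    IsOpen (posSet u univ) := by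
  have hc : Continuous u := continuousOn_univ.1 hu.continuousOn
  simpa [posSet] using isOpen_lt continuous_const hc

/-- A viscosity solution grows at most linearly away from its contact set. -/
theorem le_growthConst_mul_dist {u : EuclideanSpace ℝ (Fin n) → ℝ}
    (hu : IsViscositySolution u univ) {x x₀ : EuclideanSpace ℝ (Fin n)} (hx₀ : u x₀ = 0)
    (hx : 0 < u x) (hball : ball x (dist x₀ x) ⊆ posSet u univ) :
    u x ≤ growthConst n * dist x₀ x := by
  by_contra! hlt
  have hc : Continuous u := continuousOn_univ.1 hu.continuousOn
  set d := dist x₀ x with hd_def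
  have hd : 0 < d := dist_pos.2 (by rintro rfl; exact hx.ne' hx₀)
  set m : ℝ := u x / 2 ^ (n + 2) with hm_def
  have hm : Real.exp (8 * n + 1) * d < m := by
    rw [hm_def, lt_div_iff₀ (by positivity)]
    calc _ = growthConst n * d := by rw [growthConst]; ring
      _ < _ := hlt
  have hm0 : 0 < m := by positivity
  -- Chosen so that `n < κ / 8 = 2 * α * (d / 4) ^ 2`: the barrier is then strictly subharmonic at
  -- distance at least `d / 4` from `x`.
  set κ : ℝ := 8 * n + 1 with hκ_def
  have hκ : 1 ≤ κ := by rw [hκ_def]; linarith [(Nat.cast_nonneg n : (0 : ℝ) ≤ n)]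
  have hinner : ∀ z ∈ closedBall x (d / 4), m ≤ u z := by
    intro z hz
    rw [mem_closedBall] at hz
    have := harnack (isOpen_posSet_univ hu) hu.harmonic (fun z hz => hz.2.le) (p := z) (q := x)
      (r := d / 4) (R := d / 2) (by positivity) (by linarith)
      ((closedBall_subset_ball' (by linarith)).trans hball)
    rw [finrank_euclideanSpace_fin] at this
    rw [hm_def, div_le_iff₀ (by positivity)]
    have h2 : (d / 2) ^ (n + 2) = (d / 4) ^ (n + 2) * 2 ^ (n + 2) := by
      rw [← mul_pow]; congr 1; ring
    rw [h2, mul_assoc] at this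
    have := le_of_mul_le_mul_left this (by positivity)
    linarith
  set α : ℝ := κ / d ^ 2 with hα_def
  have hα : 0 < α := by positivity
  -- The constant `exp (-κ)` puts the zero level on the sphere of radius `d`. The slope there is `2
  -- * κ * m * exp (-κ) / d`, which exceeds 1 by `hm`.
  set v := barrier m α (Real.exp (-κ)) x with hv_def
  have hv : ContDiff ℝ 2 v := contDiff_barrier _ _ _ _
  have hvc : Continuous v := hv.continuous
  have hαd : -α * d ^ 2 = -κ := by rw [hα_def]; field_simp
  have hv_nonpos : ∀ z, d ≤ dist z x → v z ≤ 0 := by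
    intro z hz
    rw [dist_eq_norm] at hz
    refine mul_nonpos_of_nonneg_of_nonpos hm0.le (sub_nonpos.2 (Real.exp_le_exp.2 ?_))
    rw [← hαd]
    have : d ^ 2 ≤ ‖z - x‖ ^ 2 := by gcongr
    nlinarith
  have hv_zero : ∀ z, v z = 0 → dist z x = d := by
    intro z hz
    have h1 : Real.exp (-α * ‖z - x‖ ^ 2) = Real.exp (-κ) :=
      sub_eq_zero.1 ((mul_eq_zero.1 hz).resolve_left hm0.ne')
    have h2 := Real.exp_injective h1
    rw [← hαd] at h2
    have h3 : ‖z - x‖ ^ 2 = d ^ 2 := mul_left_cancel₀ (neg_ne_zero.2 hα.ne') h2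
    rw [dist_eq_norm]
    exact (pow_left_inj₀ (norm_nonneg _) hd.le two_ne_zero).1 h3
  have hv_pos : ∀ z, dist z x < d → 0 < v z := by
    intro z hz
    rw [dist_eq_norm] at hz
    refine mul_pos hm0 (sub_pos.2 (Real.exp_lt_exp.2 ?_))
    rw [← hαd]
    have : ‖z - x‖ ^ 2 < d ^ 2 := by gcongr
    nlinarith
  have hv_le : ∀ z, v z ≤ m := by
    intro z
    have h1 : Real.exp (-α * ‖z - x‖ ^ 2) ≤ 1 :=
      Real.exp_le_one_iff.2 (by nlinarith [sq_nonneg ‖z - x‖])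
    have h2 := Real.exp_pos (-κ)
    calc v z ≤ m * 1 := mul_le_mul_of_nonneg_left (by linarith) hm0.le
      _ = m := mul_one m
  have hv_lap : ∀ z, d / 4 ≤ dist z x → 0 < Laplacian.laplacian v z := by
    intro z hz
    rw [hv_def, laplacian_barrier, finrank_euclideanSpace_fin]
    rw [dist_eq_norm] at hz
    refine mul_pos (by positivity) (sub_pos.2 ?_)
    have h1 : (d / 4) ^ 2 ≤ ‖z - x‖ ^ 2 := by gcongr
    calc (n : ℝ) < κ / 8 := by rw [hκ_def]; linarith
      _ = 2 * α * (d / 4) ^ 2 := by rw [hα_def]; field_simp; norm_num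
      _ ≤ _ := by gcongr
  have hv_grad : ∀ z, v z = 0 → 1 < ‖gradient v z‖ := by
    intro z hz
    rw [hv_def, norm_gradient_barrier hm0.le hα.le, ← dist_eq_norm, hv_zero z hz, hαd]
    have h1 : Real.exp κ * Real.exp (-κ) = 1 := by rw [← Real.exp_add]; simp
    have h2 : d < m * Real.exp (-κ) := by
      calc d = Real.exp κ * d * Real.exp (-κ) := by linear_combination -d * h1
        _ < _ := by gcongr
    have h3 : 2 * α * m * Real.exp (-κ) * d = 2 * κ * (m * Real.exp (-κ)) / d := by
      rw [hα_def]; field_simp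
    rw [h3, lt_div_iff₀ hd]
    nlinarith
  -- Minimum principle on the annulus: `u - v` is nonnegative on both bounding spheres, and an
  -- interior minimum would contradict its strictly negative Laplacian.
  have hcomp : ∀ z, d / 4 ≤ dist z x → dist z x ≤ d → v z ≤ u z := by
    set K : Set (EuclideanSpace ℝ (Fin n)) := closedBall x d ∩ {z | d / 4 ≤ dist z x}
    have hK : IsCompact K := (isCompact_closedBall x d).inter_right
      (isClosed_le continuous_const (by fun_prop))
    obtain ⟨y, hyK, hy⟩ := hK.exists_isMinOn ⟨x₀, by simp [hd_def], by
      show d / 4 ≤ dist x₀ x; linarith⟩ (hc.sub hvc).continuousOn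
    have hy1 : d / 4 ≤ dist y x := hyK.2
    have hy2 : dist y x ≤ d := hyK.1
    have hy0 : 0 ≤ u y - v y := by
      by_contra! hneg
      rcases hy2.eq_or_lt with h | h
      · linarith [hv_nonpos y h.ge, hu.nonneg y (mem_univ y)]
      rcases hy1.eq_or_lt with h' | h'
      · linarith [hv_le y, hinner y h'.ge]
      have hmin : IsLocalMin (u - v) y := by
        have hm1 : ∀ᶠ z in 𝓝 y, z ∈ K := by
          filter_upwards [isOpen_ball.mem_nhds (show y ∈ ball x d from h),
            (isOpen_lt continuous_const (by fun_prop : Continuous fun z => dist z x)).mem_nhds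
              (show y ∈ {z | d / 4 < dist z x} from h')] with z h1 h2
          exact ⟨ball_subset_closedBall h1, (show d / 4 < dist z x from h2).le⟩
        filter_upwards [hm1] with z hz using hy hz
      have hharm := hu.harmonic y (hball h)
      have h1 : 0 ≤ Laplacian.laplacian (u - v) y :=
        laplacian_nonneg_of_isLocalMin (hharm.1.sub hv.contDiffAt) hmin
      rw [hharm.1.laplacian_sub hv.contDiffAt, hharm.2.eq_of_nhds] at h1
      have h2 := hv_lap y hy1
      simp only [Pi.zero_apply] at h1
      linarith
    intro z h1 h2
    have h3 : u y - v y ≤ u z - v z := hy (show z ∈ K from ⟨h2, h1⟩)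
    linarith
  have hfar : ∀ z ∈ ball x₀ (d / 2), d / 4 ≤ dist z x := by
    intro z hz
    have h1 := dist_triangle_left x₀ x z
    rw [mem_ball] at hz
    linarith
  have hsub : IsComparisonSubsolution (fun z => max (v z) 0) (ball x₀ (d / 2)) :=
    isComparisonSubsolution_max
      ⟨isOpen_ball, (convex_ball x₀ _).isConnected ⟨x₀, mem_ball_self (by positivity)⟩⟩ hv
      (fun z hz _ => (hv_lap z (hfar z hz)).le) (fun z _ => hv_grad z)
  have hcl : x₀ ∈ closure (ball x d) := by
    rw [closure_ball x hd.ne']; exact hd_def.ge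
  have hfb : x₀ ∈ freeBoundary u univ :=
    ⟨⟨closure_mono hball hcl, fun h => (interior_subset h).2.ne' hx₀⟩, mem_univ _⟩
  refine hu.not_touch_below x₀ hfb _ _ (subset_univ _) hsub
    ⟨⟨⟨?_, fun h => ?_⟩, mem_ball_self (by positivity)⟩, ?_⟩
  · show x₀ ∈ closure (posSet (fun z => max (v z) 0) (ball x₀ (d / 2)))
    have hss : ball x₀ (d / 2) ∩ ball x d ⊆ posSet (fun z => max (v z) 0) (ball x₀ (d / 2)) :=
      fun z hz => ⟨hz.1, lt_max_of_lt_left (hv_pos z hz.2)⟩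
    exact closure_mono hss (isOpen_ball.inter_closure ⟨mem_ball_self (by positivity), hcl⟩)
  · have : 0 < max (v x₀) 0 := (interior_subset h).2
    rw [max_eq_right (hv_nonpos x₀ le_rfl)] at this
    exact lt_irrefl _ this
  · filter_upwards [isOpen_ball.mem_nhds (mem_ball_self (by positivity : 0 < d / 2))] with z hz
    refine max_le ?_ (hu.nonneg z (mem_univ z))
    rcases le_total (dist z x) d with h | h
    · exact hcomp z (hfar z hz) h
    · exact (hv_nonpos z h).trans (hu.nonneg z (mem_univ z))

/-! ### Increments along `e` and the sliding argument -/

lemma harmonicAt_comp_add_right {E : Type*} [NormedAddCommGroup E] [InnerProductSpace ℝ E]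
    [FiniteDimensional ℝ E] {f : E → ℝ} {a x : E} (h : InnerProductSpace.HarmonicAt f (x + a)) :
    InnerProductSpace.HarmonicAt (fun z => f (z + a)) x := by
  refine ⟨h.1.comp x (by fun_prop), ?_⟩
  have ht : Tendsto (fun z => z + a) (𝓝 x) (𝓝 (x + a)) :=
    (continuous_add_const a).continuousAt
  filter_upwards [ht.eventually h.2] with z hz
  rw [InnerProductSpace.laplacian_eq_iteratedFDeriv_stdOrthonormalBasis] at hz ⊢
  simpa only [iteratedFDeriv_comp_add_right, Pi.zero_apply] using hz

variable {n : ℕ} {u : EuclideanSpace ℝ (Fin n) → ℝ} {e : EuclideanSpace ℝ (Fin n)}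

lemma growthConst_pos (n : ℕ) : 0 < growthConst n := by unfold growthConst; positivity

lemma mem_posSet_univ_of_ne {x : EuclideanSpace ℝ (Fin n)} (hu : IsViscositySolution u univ)
    (hx : u x ≠ 0) : x ∈ posSet u univ :=
  ⟨mem_univ x, (hu.nonneg x (mem_univ x)).lt_of_ne' hx⟩

/-- The only place where the inclusion of contact sets is used: a zero at `x + t • e` would be the
translate of a zero at `x`. -/
lemma IsGraphicalSolution.add_smul_mem_posSet (hu : IsGraphicalSolution u e)
    {x : EuclideanSpace ℝ (Fin n)} (hx : x ∈ posSet u univ) {t : ℝ} (ht : 0 ≤ t) :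
    x + t • e ∈ posSet u univ := by
  rcases ht.eq_or_lt with rfl | ht
  · simpa using hx
  refine mem_posSet_univ_of_ne hu.1 fun h => ?_
  obtain ⟨y, hy, hyx⟩ := hu.2 t ht (show x + t • e ∈ contactSet u from h)
  rw [add_right_cancel hyx] at hy
  exact hx.2.ne' hy

/-- Every positivity point is the center of a ball of positivity whose radius controls the value of
the solution. -/
lemma exists_ball_subset_posSet (hu : IsViscositySolution u univ) (hne : (contactSet u).Nonempty)
    {x : EuclideanSpace ℝ (Fin n)} (hx : 0 < u x) :
    ∃ d : ℝ, 0 < d ∧ ball x d ⊆ posSet u univ ∧ u x ≤ growthConst n * d := by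
  have hc : Continuous u := continuousOn_univ.1 hu.continuousOn
  have hcl : IsClosed (contactSet u) := isClosed_eq hc continuous_const
  obtain ⟨x₀, hx₀, hd⟩ := hcl.exists_infDist_eq_dist hne x
  have hball : ball x (dist x₀ x) ⊆ posSet u univ := by
    intro z hz
    rw [dist_comm, ← hd] at hz
    exact mem_posSet_univ_of_ne hu fun h => (disjoint_ball_infDist.le_bot ⟨hz, h⟩)
  exact ⟨dist x₀ x, dist_pos.2 (by rintro rfl; exact hx.ne' hx₀), hball,
    le_growthConst_mul_dist hu hx₀ hx hball⟩

/-- A nonnegative harmonic function on the whole space is constant. -/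
lemma le_of_contactSet_eq_empty (hu : IsViscositySolution u univ) (hΛ : contactSet u = ∅)
    (x y : EuclideanSpace ℝ (Fin n)) : u x ≤ u y := by
  have hpos : ∀ z, z ∈ posSet u univ := fun z =>
    mem_posSet_univ_of_ne hu fun h => (hΛ ▸ (show z ∈ contactSet u from h) : z ∈ (∅ : Set _))
  set s := dist y x
  have hs : 0 ≤ s := dist_nonneg
  -- Balls of every radius are admissible, and the Harnack factor tends to 1 as `r → ∞`.
  have hr : ∀ r : ℝ, 0 < r → (r / (r + s)) ^ (n + 2) * u x ≤ u y := by
    intro r hr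
    have := harnack (isOpen_posSet_univ hu) hu.harmonic (fun z hz => hz.2.le) (p := y) (q := x)
      hr le_rfl (fun z _ => hpos z)
    rw [finrank_euclideanSpace_fin] at this
    rw [div_pow, div_mul_eq_mul_div, div_le_iff₀ (by positivity), mul_comm (u y)]
    exact this
  have hlim : Tendsto (fun r : ℝ => (r / (r + s)) ^ (n + 2) * u x) atTop (𝓝 (1 ^ (n + 2) * u x)) := by
    refine Tendsto.mul_const _ (Tendsto.pow ?_ _)
    have h1 : Tendsto (fun r : ℝ => 1 - s / (r + s)) atTop (𝓝 (1 - 0)) :=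
      tendsto_const_nhds.sub ((tendsto_atTop_add_const_right _ s tendsto_id).const_div_atTop s)
    rw [sub_zero] at h1
    refine h1.congr' ?_
    filter_upwards [eventually_gt_atTop 0] with r hr
    field_simp
    ring
  have := le_of_tendsto hlim (by filter_upwards [eventually_gt_atTop 0] with r h using hr r h)
  simpa using this

/-- The difference quotients of a solution in the direction `e` are bounded below. -/
lemma IsGraphicalSolution.exists_sub_ge (hu : IsGraphicalSolution u e) (he : ‖e‖ = 1)
    (hne : (contactSet u).Nonempty) :
    ∃ M : ℝ, ∀ (x : EuclideanSpace ℝ (Fin n)) (τ : ℝ), 0 ≤ τ →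
      -(M * τ) ≤ u (x + τ • e) - u x := by
  refine ⟨4 * (n + 2) * growthConst n, fun x τ hτ => ?_⟩
  have hC := growthConst_pos n
  have hn : (0 : ℝ) ≤ n := Nat.cast_nonneg n
  have hnn := hu.1.nonneg (x + τ • e) (mem_univ _)
  rcases (hu.1.nonneg x (mem_univ x)).eq_or_lt with hx | hx
  · rw [← hx, sub_zero]
    exact (neg_nonpos.2 (by positivity)).trans hnn
  obtain ⟨d, hd, hball, hle⟩ := exists_ball_subset_posSet hu.1 hne hx
  rcases hτ.eq_or_lt with rfl | hτ0
  · simp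
  -- If `d ≤ 4 * τ`, linear growth alone bounds `u x` by a multiple of `τ`. Otherwise Harnack with
  -- radii `d - 3 * τ` and `d - 2 * τ` keeps the closed ball inside `ball x d`, and Bernoulli bounds
  -- the relative loss by `3 * (n + 2) * τ / d`.
  rcases le_or_gt d (4 * τ) with h | h
  · have : growthConst n * d ≤ growthConst n * (4 * τ) := by gcongr
    have h2 : 0 ≤ growthConst n * τ := by positivity
    nlinarith [mul_nonneg hn h2]
  · have hdist : dist (x + τ • e) x = τ := by
      rw [dist_eq_norm, add_sub_cancel_left, norm_smul, he, mul_one, Real.norm_of_nonneg hτ]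
    have hh := harnack (isOpen_posSet_univ hu.1) hu.1.harmonic (fun z hz => hz.2.le)
      (p := x + τ • e) (q := x) (r := d - 3 * τ) (R := d - 2 * τ) (by linarith)
      (by rw [hdist]; linarith)
      ((closedBall_subset_ball' (by rw [hdist]; linarith)).trans hball)
    rw [finrank_euclideanSpace_fin] at hh
    have hbern := one_add_mul_le_pow (a := -(3 * τ / d))
      (by have : 3 * τ / d ≤ 1 := (div_le_one hd).2 (by linarith)
          linarith) (n + 2)
    have h1 : d ^ (n + 2) * (1 + -(3 * τ / d)) ^ (n + 2) * u x ≤ d ^ (n + 2) * u (x + τ • e) := by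
      rw [← mul_pow, show d * (1 + -(3 * τ / d)) = d - 3 * τ by field_simp; ring]
      refine hh.trans (mul_le_mul_of_nonneg_right ?_ hnn)
      exact pow_le_pow_left₀ (by linarith) (by linarith) _
    rw [mul_assoc] at h1
    have h2 := le_of_mul_le_mul_left h1 (by positivity)
    have h3 := mul_le_mul_of_nonneg_right hbern hx.le
    have h4 : 3 * τ / d * u x ≤ 3 * τ * growthConst n := by
      rw [div_mul_eq_mul_div, div_le_iff₀ hd]
      calc 3 * τ * u x ≤ 3 * τ * (growthConst n * d) := by gcongr
        _ = _ := by ring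
    have h5 := mul_le_mul_of_nonneg_left h4 (by positivity : (0 : ℝ) ≤ n + 2)
    push_cast at h3
    have h6 : 0 ≤ (n + 2) * (growthConst n * τ) := by positivity
    nlinarith

/-- Harnack inequality along a ray. -/
lemma harnack_ray {w : EuclideanSpace ℝ (Fin n) → ℝ} {S : Set (EuclideanSpace ℝ (Fin n))}
    (hS : IsOpen S) (hw : InnerProductSpace.HarmonicOnNhd w S) (hw0 : ∀ z ∈ S, 0 ≤ w z)
    (he : ‖e‖ = 1) {x : EuclideanSpace ℝ (Fin n)} {d : ℝ} (hd : 0 < d)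
    (hball : ∀ t : ℝ, 0 ≤ t → ball (x + t • e) d ⊆ S) (j : ℕ) :
    ∀ t : ℝ, 0 ≤ t → t ≤ j * (d / 4) → w (x + t • e) ≤ (2 ^ (n + 2)) ^ j * w x := by
  induction j with
  | zero =>
    intro t h0 h1
    have : t = 0 := le_antisymm (by simpa using h1) h0
    simp [this]
  | succ j ih =>
    intro t h0 h1
    -- Step back by `d / 4`, stopping at the origin of the ray; each link of the Harnack chain costs
    -- a factor `2 ^ (n + 2)`.
    set s := max (t - d / 4) 0 with hs
    have hs0 : 0 ≤ s := le_max_right _ _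
    have hsj : s ≤ j * (d / 4) := by
      refine max_le ?_ (by positivity)
      push_cast at h1
      linarith
    have hst : s ≤ t := max_le (by linarith) h0
    have hts : t - d / 4 ≤ s := le_max_left _ _
    have hdist : dist (x + s • e) (x + t • e) ≤ d / 4 := by
      rw [dist_add_left, dist_eq_norm, ← sub_smul, norm_smul, he, mul_one, Real.norm_eq_abs,
        abs_sub_comm, abs_of_nonneg (by linarith)]
      linarith
    have hh := harnack hS hw hw0 (p := x + s • e) (q := x + t • e) (r := d / 4) (R := d / 2)
      (by positivity) (by linarith)
      ((closedBall_subset_ball (by linarith)).trans (hball s hs0))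
    rw [finrank_euclideanSpace_fin, show d / 2 = d / 4 * 2 by ring, mul_pow, mul_assoc] at hh
    have h2 := le_of_mul_le_mul_left hh (by positivity)
    calc w (x + t • e) ≤ 2 ^ (n + 2) * w (x + s • e) := h2
      _ ≤ 2 ^ (n + 2) * ((2 ^ (n + 2)) ^ j * w x) := by gcongr; exact ih s hs0 hsj
      _ = _ := by ring

/-- A solution whose contact set is a union of half-lines in the direction `-e` is monotone in the
direction `e`. -/
theorem IsGraphicalSolution.le_add_smul (hu : IsGraphicalSolution u e) (he : ‖e‖ = 1)
    (x : EuclideanSpace ℝ (Fin n)) (τ : ℝ) (hτ : 0 ≤ τ) : u x ≤ u (x + τ • e) := by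
  rcases (contactSet u).eq_empty_or_nonempty with hΛ | hne
  · exact le_of_contactSet_eq_empty hu.1 hΛ _ _
  set T : Set ℝ := {M | ∀ (x : EuclideanSpace ℝ (Fin n)) (τ : ℝ), 0 ≤ τ →
    -(M * τ) ≤ u (x + τ • e) - u x} with hT
  have hTne : T.Nonempty := hu.exists_sub_ge he hne
  suffices h0 : (0 : ℝ) ∈ T by simpa using h0 x τ hτ
  by_contra h0
  have hTpos : ∀ M ∈ T, 0 < M := by
    intro M hM
    by_contra! hneg
    refine h0 fun x τ hτ => le_trans ?_ (hM x τ hτ)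
    nlinarith
  have hTbdd : BddBelow T := ⟨0, fun M hM => (hTpos M hM).le⟩
  have hTcl : IsClosed T := by
    simp only [hT, ofPred_forall]
    exact isClosed_iInter fun x => isClosed_iInter fun τ => isClosed_iInter fun _ =>
      isClosed_le (by fun_prop) continuous_const
  set M := sInf T with hM_def
  have hMT : M ∈ T := hTcl.csInf_mem hTne hTbdd
  have hM : 0 < M := hTpos M hMT
  have hC := growthConst_pos n
  -- Descending at rate `M / 2` over length `L * d` loses `growthConst n * d`, at least the initial
  -- height. The `j` links of length `d / 4` cover this stretch, and `δ` is such that `B * δ = M /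
  -- 2`.
  set L : ℝ := 2 * growthConst n / M with hL
  have hL0 : 0 < L := by positivity
  set j : ℕ := ⌈4 * L⌉₊ with hj
  set B : ℝ := (2 ^ (n + 2)) ^ j with hB
  have hB1 : 1 ≤ B := one_le_pow₀ (one_le_pow₀ one_le_two)
  set δ : ℝ := M / (2 * B) with hδ
  have hδ0 : 0 < δ := by positivity
  have hδM : δ < M := div_lt_self hM (by linarith)
  have hnot : M - δ ∉ T := fun h => by linarith [csInf_le hTbdd h]
  simp only [hT, mem_ofPred_eq, not_forall, not_le] at hnot
  obtain ⟨y, σ, hσ0, hy⟩ := hnot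
  have hσ : 0 < σ := hσ0.lt_of_ne (by rintro rfl; simp at hy)
  have hyσ := hu.1.nonneg (y + σ • e) (mem_univ _)
  have huy : 0 < u y := by
    have : 0 < (M - δ) * σ := mul_pos (by linarith) hσ
    linarith
  obtain ⟨d, hd, hball, hle⟩ := exists_ball_subset_posSet hu.1 hne huy
  have hballs : ∀ t : ℝ, 0 ≤ t → ball (y + t • e) d ⊆ posSet u univ := by
    intro t ht z hz
    have h1 : z - t • e ∈ ball y d := by
      rw [mem_ball_iff_norm] at hz ⊢
      rwa [sub_sub, add_comm (t • e)]
    simpa using hu.add_smul_mem_posSet (hball h1) ht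
  set w : EuclideanSpace ℝ (Fin n) → ℝ := fun z => u (z + σ • e) - u z + M * σ with hw_def
  have hw : InnerProductSpace.HarmonicOnNhd w (posSet u univ) := fun z hz =>
    ((harmonicAt_comp_add_right (hu.1.harmonic _ (hu.add_smul_mem_posSet hz hσ0))).sub
      (hu.1.harmonic z hz)).add (InnerProductSpace.harmonicAt_const (M * σ))
  have hw0 : ∀ z ∈ posSet u univ, 0 ≤ w z := fun z _ => by
    have := hMT z σ hσ0
    simp only [hw_def]; linarith
  have hwy : w y ≤ δ * σ := by simp only [hw_def]; linarith
  have hstep : ∀ t : ℝ, 0 ≤ t → t ≤ L * d →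
      u (y + t • e + σ • e) ≤ u (y + t • e) - M / 2 * σ := by
    intro t ht0 ht
    have h1 : t ≤ j * (d / 4) := by
      have := Nat.le_ceil (4 * L)
      nlinarith
    have h2 := harnack_ray (isOpen_posSet_univ hu.1) hw hw0 he hd hballs j t ht0 h1
    have h3 : B * w y ≤ B * (δ * σ) := by gcongr
    have h4 : B * (δ * σ) = M / 2 * σ := by rw [hδ]; field_simp
    simp only [hw_def] at h2 h3
    linarith
  -- Only the start of each step must lie in the stretch of length `L * d`, so `m + 1` steps are
  -- allowed and their total length strictly exceeds `L * d`; even `m = 0` works.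
  set m : ℕ := ⌊L * d / σ⌋₊ with hm
  have hmσ : m * σ ≤ L * d := by
    rw [← le_div_iff₀ hσ]; exact Nat.floor_le (by positivity)
  have hmσ' : L * d < (m + 1) * σ := by
    rw [← div_lt_iff₀ hσ]; exact Nat.lt_floor_add_one _
  have hiter : ∀ i : ℕ, i ≤ m + 1 → u (y + (i * σ) • e) ≤ u y - i * (M / 2 * σ) := by
    intro i
    induction i with
    | zero => simp
    | succ i ih =>
      intro hi
      have h1 := ih (by omega)
      have him : (i : ℝ) ≤ m := by exact_mod_cast (by omega : i ≤ m)
      have h2 := hstep (i * σ) (by positivity) (le_trans (by gcongr) hmσ)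
      rw [add_assoc, ← add_smul] at h2
      push_cast
      rw [show ((i : ℝ) + 1) * σ = i * σ + σ by ring]
      linarith
  have hfinal := hiter (m + 1) le_rfl
  have hnn := hu.1.nonneg (y + ((m + 1 : ℕ) * σ) • e) (mem_univ _)
  push_cast at hfinal hnn
  have h1 : M / 2 * (L * d) = growthConst n * d := by rw [hL]; field_simp
  have h2 : M / 2 * (L * d) < M / 2 * ((m + 1) * σ) := by gcongr
  linarith

end OnePhase

theorem mainTheorem11 (n : ℕ) (u : EuclideanSpace ℝ (Fin (n + 1)) → ℝ)
    (hu : OnePhase.IsGraphicalSolution u (EuclideanSpace.single (Fin.last n) (1 : ℝ))) :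
    ∀ (x : EuclideanSpace ℝ (Fin (n + 1))) (τ : ℝ), 0 ≤ τ →
      u x ≤ u (x + τ • EuclideanSpace.single (Fin.last n) (1 : ℝ)) :=
  hu.le_add_smul (by simp)
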